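/- Let $k$ be a field and let $1\le a\le\infty$. Let $A=\bigoplus_{0\le i<a}A_i$ be a graded tdvr (graded truncated discrete valuation ring) of length $a$, that is, a commutative graded ring with $A_0=k$ such that for every $0\le i<a$ the part $A_i$ is a one-dimensional $k$-vector space generated by $(A_1)^i$ (for $a=\infty$ the sum is the usual infinite direct sum; thus $A\cong k[\varpi]/(\varpi^a)$ if $a<\infty$ and $A\cong k[\varpi]$ if $a=\infty$, graded by the degree in $\varpi$). Let $R=A[x_1,\dots,x_n]$ and $L=Re_1\oplus\dots\oplus Re_r$, and grade $L$ as $L=\bigoplus_{0\le i<a}L_i$, where $L_i$ consists of the elements of $L$ all of whose coefficients lie in $A_i$ (so the $x_j$ and $e_l$ have degree $0$). A power product in $L$ is an element $X=\boldsymbol{x}e_l$ with $\boldsymbol{x}$ a monomial in $x_1,\dots,x_n$. Fix a term order on the power products in $L$: a total order such that $X<\boldsymbol{x}X$ for every monomial $\boldsymbol{x}\ne1$, and $X<Y$ implies $\boldsymbol{x}X<\boldsymbol{x}Y$ for every monomial $\boldsymbol{x}$. For $0\ne f\in L$ let $\operatorname{lp}(f)$ be the largest power product that occurs in $f$, $\operatorname{lc}(f)\in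 A$ its coefficient, and $\operatorname{lt}(f)=\operatorname{lc}(f)\operatorname{lp}(f)$; put $\operatorname{lt}(0)=0$ and regard $\operatorname{lp}(0)$ as smaller than every power product. For a finite set $F=\{f_1,\dots,f_s\}\subset L\smallsetminus\{0\}$ write $f\to h$ if there are $a_i\in A$ and monomials $\boldsymbol{x}_i$ with $h=f-\sum_i a_i\boldsymbol{x}_if_i$, with $\operatorname{lp}(f)=\boldsymbol{x}_i\operatorname{lp}(f_i)$ whenever $a_i\ne0$, and with $\operatorname{lt}(f)=\sum_i a_i\boldsymbol{x}_i\operatorname{lt}(f_i)$. The element $f$ can be strictly reduced with respect to $F$ if there is a finite chain $f\to h_1\to\dots\to h$ of at least one such step with $\operatorname{lp}(h)<\operatorname{lp}(f)$ (the case $h=0$ included). Let $M$ be a nonzero graded $R$-submodule of $L$, i.e. $M=\bigoplus_i (M\cap L_i)$. Let $G=\{g_1,\dots,g_t\}$ be a homogeneous Gröbner basis for $M$: a finite subset of $M\smallsetminus\{0\}$ whose elements each lie in some $L_i$ and whose leading terms generate the same $R$-submodule of $L$ as the leading terms of all elements of $M$. Suppose that $G$ is minimal, i.e. no $g\in G$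 can be strictly reduced with respect to $G\smallsetminus\{g\}$. Then $L/M$ is flat over $A$ if and only if $\operatorname{lc}(g_j)$ is a unit of $A$ for every $1\le j\le t$. -/

import Mathlib

namespace GroebnerFlat

/-- Power products `x^m e_l` of the free module `R e_1 ⊕ ⋯ ⊕ R e_r`, `R = A[x_1, …, x_n]`.
Power products `x^m` of `R` itself are represented by their exponents `m : Fin n →₀ ℕ`. -/
@[ext]
structure PowerProduct (n r : ℕ) where
  exponent : Fin n →₀ ℕ
  index : Fin r

/-- The product of `x^d` with the power product `x^m e_l`, namely `x^(d + m) e_l`. -/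
noncomputable def PowerProduct.shift {n r : ℕ} (d : Fin n →₀ ℕ) (X : PowerProduct n r) : PowerProduct n r :=
  ⟨d + X.exponent, X.index⟩

/-- The given total order on power products is a term order. -/
structure IsTermOrder (n r : ℕ) [LinearOrder (PowerProduct n r)] : Prop where
  lt_shift : ∀ (X : PowerProduct n r) (d : Fin n →₀ ℕ), d ≠ 0 → X < X.shift d
  shift_lt_shift : ∀ (X Y : PowerProduct n r) (d : Fin n →₀ ℕ),
    X < Y → X.shift d < Y.shift d

/-- The free module `L = R e_1 ⊕ ⋯ ⊕ R e_r` over `R = A[x_1, …, x_n]`. -/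
abbrev FreeMod (A : Type*) [CommRing A] (n r : ℕ) : Type _ := Fin r → MvPolynomial (Fin n) A

noncomputable section

section LeadingTerms

variable {A : Type*} [CommRing A] {n r : ℕ}

/-- The coefficient in `A` of the power product `X` in `f`. -/
def coeffAt (f : FreeMod A n r) (X : PowerProduct n r) : A :=
  MvPolynomial.coeff X.exponent (f X.index)

/-- The element `c X` of `L`. -/
def monomialElt (c : A) (X : PowerProduct n r) : FreeMod A n r :=
  Pi.single X.index (MvPolynomial.monomial X.exponent c)

theorem finite_coeffAt_ne_zero (f : FreeMod A n r) : {X | coeffAt f X ≠ 0}.Finite := by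
  classical
  refine (Set.finite_iUnion fun l : Fin r =>
    ((f l).support.finite_toSet.image fun m => PowerProduct.mk m l)).subset ?_
  intro X hX
  refine Set.mem_iUnion.2 ⟨X.index, X.exponent, ?_, rfl⟩
  exact Finset.mem_coe.2 (MvPolynomial.mem_support_iff.2 hX)

/-- The finite set of the power products that occur in `f`. -/
def supp (f : FreeMod A n r) : Finset (PowerProduct n r) := (finite_coeffAt_ne_zero f).toFinset

variable [LinearOrder (PowerProduct n r)]

/-- The leading power product, with the convention that `leadMonomial 0 = ⊥` lies below every power
product. -/
def leadMonomial (f : FreeMod A n r) : WithBot (PowerProduct n r) := (supp f).max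

/-- The leading coefficient (`0` for `f = 0`). -/
def leadCoeff (f : FreeMod A n r) : A :=
  WithBot.recBotCoe 0 (fun X => coeffAt f X) (leadMonomial f)

/-- The leading term (`0` for `f = 0`). -/
def leadTerm (f : FreeMod A n r) : FreeMod A n r :=
  WithBot.recBotCoe 0 (fun X => monomialElt (leadCoeff f) X) (leadMonomial f)

/-- The submodule generated by the leading terms of the elements of `S`. -/
def ltSubmodule (S : Set (FreeMod A n r)) : Submodule (MvPolynomial (Fin n) A) (FreeMod A n r) :=
  Submodule.span (MvPolynomial (Fin n) A) (leadTerm '' S)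

/-- `G` is a Gröbner basis for the submodule `M`. -/
def IsGroebnerBasis (G : Finset (FreeMod A n r))
    (M : Submodule (MvPolynomial (Fin n) A) (FreeMod A n r)) : Prop :=
  (∀ g ∈ G, g ∈ M ∧ g ≠ 0) ∧
    ltSubmodule (G : Set (FreeMod A n r)) = ltSubmodule (M : Set (FreeMod A n r))

/-- One reduction step `f → h` modulo `F`. The polynomial `monomial (d p) (c p)` is
`c_p x^(d_p)`. -/
def ReducesStep (F : Finset (FreeMod A n r)) (f h : FreeMod A n r) : Prop :=
  ∃ (c : FreeMod A n r → A) (d : FreeMod A n r → (Fin n →₀ ℕ)),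
    h = f - ∑ p ∈ F, MvPolynomial.monomial (d p) (c p) • p ∧
    (∀ p ∈ F, c p ≠ 0 → leadMonomial f = (leadMonomial p).map (PowerProduct.shift (d p))) ∧
    leadTerm f = ∑ p ∈ F, MvPolynomial.monomial (d p) (c p) • leadTerm p

/-- `f` reduces to `h` modulo `F`, by a finite nonempty chain of reduction steps. -/
def Reduces (F : Finset (FreeMod A n r)) (f h : FreeMod A n r) : Prop :=
  Relation.TransGen (ReducesStep F) f h

/-- `f` reduces strictly to `h` modulo `F`. -/
def ReducesStrictly (F : Finset (FreeMod A n r)) (f h : FreeMod A n r) : Prop :=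
  Reduces F f h ∧ leadMonomial h < leadMonomial f

open Classical in
/-- Minimality: no `g ∈ G` can be strictly reduced with respect to `G \ {g}`. -/
def IsMinimalBasis (G : Finset (FreeMod A n r)) : Prop :=
  ∀ g ∈ G, ¬ ∃ h, ReducesStrictly (G.erase g) g h

end LeadingTerms

section Graded

variable {k A : Type*} [Field k] [CommRing A] [Algebra k A]

/-- The grading `A = ⊕_i 𝒜 i` of the `k`-algebra `A` makes it a graded truncated discrete
valuation ring of length `a ≤ ∞`: there is nothing in degrees `≥ a`, and for `i < a` the
part `𝒜 i` is one-dimensional over `k` and spanned by the `i`-fold products of elements of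
`𝒜 1`. For `i = 0` the latter says that `𝒜 0` is the image of `k`. -/
structure IsGradedTdvr (𝒜 : ℕ → Submodule k A) [GradedAlgebra 𝒜] (a : ℕ∞) : Prop where
  length_pos : 0 < a
  finrank_eq_one : ∀ i : ℕ, (i : ℕ∞) < a → Module.finrank k (𝒜 i) = 1
  eq_pow : ∀ i : ℕ, (i : ℕ∞) < a → 𝒜 i = 𝒜 1 ^ i
  eq_bot : ∀ i : ℕ, a ≤ (i : ℕ∞) → 𝒜 i = ⊥

variable {n r : ℕ}

/-- The degree-`i` part `L_i` of `L`: all coefficients lie in `𝒜 i`. -/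
def degreePart (𝒜 : ℕ → Submodule k A) (n r i : ℕ) : Submodule k (FreeMod A n r) where
  carrier := {f | ∀ X, coeffAt f X ∈ 𝒜 i}
  add_mem' {f g} hf hg X := by
    have h : coeffAt (f + g) X = coeffAt f X + coeffAt g X := by simp [coeffAt]
    rw [h]
    exact (𝒜 i).add_mem (hf X) (hg X)
  zero_mem' X := by simp [coeffAt]
  smul_mem' c f hf X := by
    have h : coeffAt (c • f) X = c • coeffAt f X := by simp [coeffAt]
    rw [h]
    exact (𝒜 i).smul_mem c (hf X)

/-- `M` is a graded submodule: it is the sum of its parts `M ∩ L_i`. The sum is direct because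
the sum of the `L_i` is. -/
def IsGradedSubmodule (𝒜 : ℕ → Submodule k A)
    (M : Submodule (MvPolynomial (Fin n) A) (FreeMod A n r)) : Prop :=
  M.restrictScalars k = ⨆ i, M.restrictScalars k ⊓ degreePart 𝒜 n r i

/-- `g` is a nonzero homogeneous element of `L`. -/
def IsHomogeneousElt (𝒜 : ℕ → Submodule k A) (g : FreeMod A n r) : Prop :=
  g ≠ 0 ∧ ∃ i, g ∈ degreePart 𝒜 n r i

end Graded

end

end GroebnerFlat

open GroebnerFlat

/-! If the leading coefficients of `G` are units, division by `G` works over `A` as it does over a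
field. The elements of `L` in which no multiple of a leading power product of `G` occurs then form
an `A`-complement of `M`, so `L/M` is a direct summand of a free `A`-module
(`isCompl_reducedSubmodule`, `flat_quotient_of_isUnit_leadCoeff`).

Conversely, a homogeneous `g ∈ G` factors as `w • g'` with `w ≠ 0` homogeneous and the coefficients
of `g'` in `𝒜 0`, the image of `k` (`exists_eq_smul`). Flatness and the grading of `M` allow `w` to
be cancelled, so `g' ∈ M` (`mem_of_smul_mem_of_flat`). The leading coefficient of `g'` is nonzero of
degree 0, and its leading term is a combination of those of `G`. Hence some `h ∈ G` whose leading
power product divides that of `g` has leading coefficient outside the irrelevant ideal, and by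
homogeneity this is a unit. Such an `h` strictly reduces `g` unless `h = g`, so minimality gives `h
= g`. -/

namespace GroebnerFlat

/-! ### Coefficients of elements of the free module -/

section Coefficients

variable {A : Type*} [CommRing A] {n r : ℕ}

theorem coeffAt_zero (X : PowerProduct n r) : coeffAt (0 : FreeMod A n r) X = 0 := by
  simp [coeffAt]

theorem coeffAt_add (f g : FreeMod A n r) (X : PowerProduct n r) :
    coeffAt (f + g) X = coeffAt f X + coeffAt g X := by
  simp [coeffAt]

theorem coeffAt_sub (f g : FreeMod A n r) (X : PowerProduct n r) :
    coeffAt (f - g) X = coeffAt f X - coeffAt g X := by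
  simp [coeffAt]

theorem coeffAt_smul (c : A) (f : FreeMod A n r) (X : PowerProduct n r) :
    coeffAt (c • f) X = c * coeffAt f X := by
  simp [coeffAt]

theorem coeffAt_sum {ι : Type*} (s : Finset ι) (f : ι → FreeMod A n r) (X : PowerProduct n r) :
    coeffAt (∑ i ∈ s, f i) X = ∑ i ∈ s, coeffAt (f i) X := by
  simp [coeffAt, MvPolynomial.coeff_sum]

theorem ext_coeffAt {f g : FreeMod A n r} (h : ∀ X, coeffAt f X = coeffAt g X) : f = g := by
  funext l
  ext m
  exact h ⟨m, l⟩

theorem coeffAt_polynomial_smul (p : MvPolynomial (Fin n) A) (f : FreeMod A n r)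
    (X : PowerProduct n r) :
    coeffAt (p • f) X = ∑ x ∈ Finset.HasAntidiagonal.antidiagonal X.exponent,
      MvPolynomial.coeff x.1 p * coeffAt f ⟨x.2, X.index⟩ := by
  simp [coeffAt, MvPolynomial.coeff_mul]

theorem coeffAt_monomial_smul_shift (d : Fin n →₀ ℕ) (c : A) (f : FreeMod A n r)
    (X : PowerProduct n r) :
    coeffAt (MvPolynomial.monomial d c • f) (X.shift d) = c * coeffAt f X := by
  simp [coeffAt, PowerProduct.shift]

theorem coeffAt_monomial_smul_of_forall_ne (d : Fin n →₀ ℕ) (c : A) (f : FreeMod A n r)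
    (X : PowerProduct n r) (h : ∀ Y : PowerProduct n r, X ≠ Y.shift d) :
    coeffAt (MvPolynomial.monomial d c • f) X = 0 := by
  have hd : ¬ d ≤ X.exponent := fun hd =>
    h ⟨X.exponent - d, X.index⟩ (PowerProduct.ext (add_tsub_cancel_of_le hd).symm rfl)
  simp [coeffAt, MvPolynomial.coeff_monomial_mul', hd]

theorem coeffAt_monomialElt [DecidableEq (PowerProduct n r)] (c : A) (X Y : PowerProduct n r) :
    coeffAt (monomialElt c X) Y = if X = Y then c else 0 := by
  classical
  obtain ⟨m, l⟩ := X
  obtain ⟨m', l'⟩ := Y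
  by_cases hl : l' = l
  · subst hl
    simp [coeffAt, monomialElt, MvPolynomial.coeff_monomial]
  · simp [coeffAt, monomialElt, hl, Ne.symm hl]

theorem monomial_smul_monomialElt (d : Fin n →₀ ℕ) (c e : A) (X : PowerProduct n r) :
    MvPolynomial.monomial d c • monomialElt e X = monomialElt (c * e) (X.shift d) := by
  funext l
  by_cases hl : l = X.index
  · subst hl
    simp [monomialElt, PowerProduct.shift]
  · simp [monomialElt, PowerProduct.shift, hl]

theorem coeffAt_sum_monomialElt [DecidableEq (PowerProduct n r)] (s : Finset (PowerProduct n r))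
    (u : PowerProduct n r → A) (Y : PowerProduct n r) :
    coeffAt (∑ X ∈ s, monomialElt (u X) X) Y = if Y ∈ s then u Y else 0 := by
  simp [coeffAt_sum, coeffAt_monomialElt]

theorem mem_supp {f : FreeMod A n r} {X : PowerProduct n r} : X ∈ supp f ↔ coeffAt f X ≠ 0 := by
  simp [supp]

end Coefficients

/-! ### Leading terms, division, and units imply flatness -/

section LeadingTerms

variable {A : Type*} [CommRing A] {n r : ℕ} [LinearOrder (PowerProduct n r)]

theorem leadMonomial_lt_coe {f : FreeMod A n r} {X : PowerProduct n r} :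
    leadMonomial f < X ↔ ∀ Y, X ≤ Y → coeffAt f Y = 0 := by
  rw [leadMonomial, Finset.max, Finset.sup_lt_iff (WithBot.bot_lt_coe X)]
  refine forall_congr' fun Y => ?_
  rw [mem_supp, WithBot.coe_lt_coe, ← not_le, not_imp_not]

theorem coeffAt_eq_zero_of_leadMonomial_lt {f : FreeMod A n r} {X : PowerProduct n r}
    (h : leadMonomial f < X) : coeffAt f X = 0 :=
  leadMonomial_lt_coe.1 h X le_rfl

theorem leadCoeff_eq {f : FreeMod A n r} {X : PowerProduct n r} (h : leadMonomial f = X) :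
    leadCoeff f = coeffAt f X := by
  simp [leadCoeff, h]

theorem leadTerm_eq {f : FreeMod A n r} {X : PowerProduct n r} (h : leadMonomial f = X) :
    leadTerm f = monomialElt (leadCoeff f) X := by
  simp [leadTerm, h]

theorem leadCoeff_ne_zero {f : FreeMod A n r} {X : PowerProduct n r} (h : leadMonomial f = X) :
    leadCoeff f ≠ 0 := by
  rw [leadCoeff_eq h]
  exact mem_supp.1 (Finset.mem_of_max h)

theorem exists_leadMonomial_eq {f : FreeMod A n r} (hf : f ≠ 0) :
    ∃ X : PowerProduct n r, leadMonomial f = X := by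
  have hs : (supp f).Nonempty := by
    by_contra hs
    rw [Finset.not_nonempty_iff_eq_empty] at hs
    refine hf (ext_coeffAt fun X => ?_)
    rw [coeffAt_zero]
    by_contra hX
    simpa [hs] using mem_supp.2 hX
  exact Finset.max_of_nonempty hs

/-- `X` is a multiple of the leading power product of `f`. -/
def LeadDivides (f : FreeMod A n r) (X : PowerProduct n r) : Prop :=
  ∃ (d : Fin n →₀ ℕ) (Y : PowerProduct n r), leadMonomial f = Y ∧ X = Y.shift d

theorem LeadDivides.of_antidiagonal {f : FreeMod A n r} {X : PowerProduct n r}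
    {x : (Fin n →₀ ℕ) × (Fin n →₀ ℕ)} (hx : x ∈ Finset.HasAntidiagonal.antidiagonal X.exponent)
    (h : LeadDivides f ⟨x.2, X.index⟩) : LeadDivides f X := by
  obtain ⟨d, Y, hY, hXY⟩ := h
  refine ⟨x.1 + d, Y, hY, PowerProduct.ext ?_ ((congrArg PowerProduct.index hXY :))⟩
  rw [← Finset.HasAntidiagonal.mem_antidiagonal.1 hx, show x.2 = d + Y.exponent from
    congrArg PowerProduct.exponent hXY, PowerProduct.shift, add_assoc]

/-- Only leading terms whose power product divides `X` can contribute to the coefficient at `X`.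
Used with `I = ⊥` for division and with the irrelevant ideal for the converse. -/
theorem coeffAt_mem_of_mem_ltSubmodule {S : Set (FreeMod A n r)} {f : FreeMod A n r}
    (hf : f ∈ ltSubmodule S) (I : Ideal A) {X : PowerProduct n r}
    (hX : ∀ g ∈ S, LeadDivides g X → leadCoeff g ∈ I) : coeffAt f X ∈ I := by
  induction hf using Submodule.span_induction generalizing X with
  | mem f hf =>
    obtain ⟨g, hg, rfl⟩ := hf
    by_cases h0 : g = 0
    · simp [h0, leadTerm, leadMonomial, supp, coeffAt_zero]
    · obtain ⟨Y, hY⟩ := exists_leadMonomial_eq h0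
      rw [leadTerm_eq hY, coeffAt_monomialElt]
      split_ifs with hYX
      · exact hX g hg ⟨0, Y, hY, by simp [← hYX, PowerProduct.shift]⟩
      · exact I.zero_mem
  | zero => simp [coeffAt_zero]
  | add f g _ _ hf hg =>
    rw [coeffAt_add]
    exact I.add_mem (hf hX) (hg hX)
  | smul p f _ hf =>
    rw [coeffAt_polynomial_smul]
    exact I.sum_mem fun x hx => I.mul_mem_left _
      (hf fun g hg hd => hX g hg (hd.of_antidiagonal hx))

theorem IsTermOrder.shift_le_shift (hord : IsTermOrder n r) {X Y : PowerProduct n r}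
    (d : Fin n →₀ ℕ) (h : X ≤ Y) : X.shift d ≤ Y.shift d := by
  rcases h.eq_or_lt with rfl | h
  · exact le_rfl
  · exact (hord.shift_lt_shift X Y d h).le

theorem IsTermOrder.le_shift (hord : IsTermOrder n r) (X : PowerProduct n r) (d : Fin n →₀ ℕ) :
    X ≤ X.shift d := by
  by_cases hd : d = 0
  · simp [hd, PowerProduct.shift]
  · exact (hord.lt_shift X d hd).le

/-- Dickson's lemma: a strictly descending sequence has a subsequence with monotone exponents. Two
of its members share the index in `Fin r`, so the earlier divides the later and cannot exceed it. -/
theorem IsTermOrder.wellFoundedLT (hord : IsTermOrder n r) : WellFoundedLT (PowerProduct n r) := by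
  refine ⟨RelEmbedding.wellFounded_iff_isEmpty.2 ⟨fun X => ?_⟩⟩
  obtain ⟨φ, hφ⟩ := (Set.isPWO_of_wellQuasiOrderedLE (Set.univ : Set (Fin n →₀ ℕ))).exists_monotone_subseq
    (f := fun i => (X i).exponent) (fun _ => Set.mem_univ _)
  obtain ⟨i, j, hij, hidx⟩ :=
    Finite.exists_ne_map_eq_of_infinite fun i : ℕ => (X (φ i)).index
  wlog hlt : i < j generalizing i j
  · exact this j i hij.symm hidx.symm (lt_of_le_of_ne (not_lt.1 hlt) hij.symm)
  have hle : X (φ i) ≤ X (φ j) := by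
    have : X (φ j) = (X (φ i)).shift ((X (φ j)).exponent - (X (φ i)).exponent) :=
      PowerProduct.ext (tsub_add_cancel_of_le (hφ hlt.le)).symm hidx.symm
    rw [this]
    exact hord.le_shift _ _
  exact hle.not_gt (X.map_rel_iff.2 (φ.lt_iff_lt.2 hlt))

theorem leadMonomial_sub_lt {f h : FreeMod A n r} {X : PowerProduct n r}
    (hf : leadMonomial f = X) (hh : ∀ Y, X < Y → coeffAt h Y = 0)
    (hX : coeffAt h X = leadCoeff f) : leadMonomial (f - h) < leadMonomial f := by
  rw [hf, leadMonomial_lt_coe]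
  intro Y hY
  rw [coeffAt_sub]
  rcases hY.eq_or_lt with rfl | hY
  · rw [hX, leadCoeff_eq hf, sub_self]
  · rw [hh Y hY, coeffAt_eq_zero_of_leadMonomial_lt (hf ▸ WithBot.coe_lt_coe.2 hY), sub_zero]

theorem leadMonomial_sub_monomial_smul_lt (hord : IsTermOrder n r) {f p : FreeMod A n r}
    {Y : PowerProduct n r} {d : Fin n →₀ ℕ} {u : A} (hp : leadMonomial p = Y)
    (hf : leadMonomial f = Y.shift d) (hu : u * leadCoeff p = leadCoeff f) :
    leadMonomial (f - MvPolynomial.monomial d u • p) < leadMonomial f := by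
  refine leadMonomial_sub_lt hf (fun Z hZ => ?_) ?_
  · by_cases h : ∃ W : PowerProduct n r, Z = W.shift d
    · obtain ⟨W, rfl⟩ := h
      have hYW : Y < W := lt_of_not_ge fun h => (hord.shift_le_shift d h).not_gt hZ
      rw [coeffAt_monomial_smul_shift,
        coeffAt_eq_zero_of_leadMonomial_lt (hp ▸ WithBot.coe_lt_coe.2 hYW), mul_zero]
    · exact coeffAt_monomial_smul_of_forall_ne _ _ _ _ (not_exists.1 h)
  · rw [coeffAt_monomial_smul_shift, ← leadCoeff_eq hp, hu]

theorem exists_reducesStrictly (hord : IsTermOrder n r) {F : Finset (FreeMod A n r)}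
    {f p : FreeMod A n r} (hpF : p ∈ F) {X : PowerProduct n r} (hf : leadMonomial f = X)
    (hdvd : LeadDivides p X) (hp : IsUnit (leadCoeff p)) : ∃ h, ReducesStrictly F f h := by
  classical
  obtain ⟨d, Y, hY, rfl⟩ := hdvd
  obtain ⟨v, hv⟩ := hp.exists_left_inv
  have hu : leadCoeff f * v * leadCoeff p = leadCoeff f := by rw [mul_assoc, hv, mul_one]
  refine ⟨f - MvPolynomial.monomial d (leadCoeff f * v) • p, Relation.TransGen.single
    ⟨fun q => if q = p then leadCoeff f * v else 0, fun _ => d, ?_, ?_, ?_⟩,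
    leadMonomial_sub_monomial_smul_lt hord hY hf hu⟩
  · rw [Finset.sum_eq_single_of_mem p hpF fun q _ hq => by simp [hq]]
    simp
  · intro q _ hq
    obtain rfl : q = p := by
      by_contra h
      simp [h] at hq
    rw [hf, hY, WithBot.map_coe]
  · rw [Finset.sum_eq_single_of_mem p hpF fun q _ hq => by simp [hq]]
    simp only [if_true]
    rw [leadTerm_eq hf, leadTerm_eq hY, monomial_smul_monomialElt, hu]

/-- The `A`-module of the elements of `L` in which no multiple of the leading power product of an
element of `G` occurs. -/
def reducedSubmodule (G : Finset (FreeMod A n r)) : Submodule A (FreeMod A n r) where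
  carrier := {f | ∀ X, (∃ g ∈ G, LeadDivides g X) → coeffAt f X = 0}
  add_mem' {f g} hf hg X hX := by rw [coeffAt_add, hf X hX, hg X hX, add_zero]
  zero_mem' X _ := coeffAt_zero X
  smul_mem' c f hf X hX := by rw [coeffAt_smul, hf X hX, mul_zero]

/-- The division algorithm: the leading term is either cancelled by a multiple of some `g ∈ G` or
moved to the remainder, and the leading power product drops. -/
theorem mem_reducedSubmodule_sup (hord : IsTermOrder n r) {G : Finset (FreeMod A n r)}
    {M : Submodule (MvPolynomial (Fin n) A) (FreeMod A n r)} (hG : ∀ g ∈ G, g ∈ M)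
    (hunit : ∀ g ∈ G, IsUnit (leadCoeff g)) (f : FreeMod A n r) :
    f ∈ reducedSubmodule G ⊔ M.restrictScalars A := by
  have := hord.wellFoundedLT
  generalize hm : leadMonomial f = m
  induction m using WellFoundedLT.induction generalizing f with
  | ind m ih =>
  subst hm
  by_cases h0 : f = 0
  · exact h0 ▸ Submodule.zero_mem _
  obtain ⟨X, hX⟩ := exists_leadMonomial_eq h0
  obtain ⟨q, hq, hlt⟩ : ∃ q ∈ reducedSubmodule G ⊔ M.restrictScalars A,
      leadMonomial (f - q) < leadMonomial f := by
    by_cases hdvd : ∃ g ∈ G, LeadDivides g X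
    · obtain ⟨g, hg, d, Y, hY, rfl⟩ := hdvd
      obtain ⟨v, hv⟩ := (hunit g hg).exists_left_inv
      refine ⟨MvPolynomial.monomial d (leadCoeff f * v) • g,
        (le_sup_right : M.restrictScalars A ≤ _) (M.smul_mem _ (hG g hg)),
        leadMonomial_sub_monomial_smul_lt hord hY hX ?_⟩
      rw [mul_assoc, hv, mul_one]
    · refine ⟨monomialElt (leadCoeff f) X,
        (le_sup_left : reducedSubmodule G ≤ _) fun Y hY => ?_, leadMonomial_sub_lt hX ?_ ?_⟩
      · rw [coeffAt_monomialElt, if_neg]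
        rintro rfl
        exact hdvd hY
      · intro Y hY
        rw [coeffAt_monomialElt, if_neg hY.ne]
      · rw [coeffAt_monomialElt, if_pos rfl]
  simpa using Submodule.add_mem _ (ih _ hlt (f - q) rfl) hq

theorem isCompl_reducedSubmodule (hord : IsTermOrder n r) {G : Finset (FreeMod A n r)}
    {M : Submodule (MvPolynomial (Fin n) A) (FreeMod A n r)} (hG : IsGroebnerBasis G M)
    (hunit : ∀ g ∈ G, IsUnit (leadCoeff g)) :
    IsCompl (M.restrictScalars A) (reducedSubmodule G) := by
  refine IsCompl.symm ⟨Submodule.disjoint_def.2 fun f hfS hfM => ?_, codisjoint_iff.2 <|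
    eq_top_iff.2 fun f _ => mem_reducedSubmodule_sup hord (fun g hg => (hG.1 g hg).1) hunit f⟩
  by_contra h0
  obtain ⟨X, hX⟩ := exists_leadMonomial_eq h0
  have hlt : leadTerm f ∈ ltSubmodule (G : Set (FreeMod A n r)) := by
    rw [hG.2]
    exact Submodule.subset_span ⟨f, hfM, rfl⟩
  -- No leading power product of `G` divides `X`, as `X` occurs in the reduced element `f`; the
  -- condition for `I = ⊥` is vacuous.
  have hcoeff := coeffAt_mem_of_mem_ltSubmodule hlt ⊥ (X := X) fun g hg hd =>
    absurd (hfS X ⟨g, hg, hd⟩) (leadCoeff_eq hX ▸ leadCoeff_ne_zero hX)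
  rw [leadTerm_eq hX, coeffAt_monomialElt, if_pos rfl] at hcoeff
  exact leadCoeff_ne_zero hX hcoeff

/-- If the leading coefficients of a Gröbner basis are units, then `L/M` is a direct summand of
`L` as an `A`-module. -/
theorem flat_quotient_of_isUnit_leadCoeff (hord : IsTermOrder n r) {G : Finset (FreeMod A n r)}
    {M : Submodule (MvPolynomial (Fin n) A) (FreeMod A n r)} (hG : IsGroebnerBasis G M)
    (hunit : ∀ g ∈ G, IsUnit (leadCoeff g)) : Module.Flat A (FreeMod A n r ⧸ M) := by
  let e : (FreeMod A n r ⧸ M) ≃ₗ[A] reducedSubmodule G :=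
    (Submodule.Quotient.restrictScalarsEquiv A M).symm.trans
      (Submodule.quotientEquivOfIsCompl _ _ (isCompl_reducedSubmodule hord hG hunit))
  -- The complement is a retract of the free `A`-module `L`.
  have hproj : Module.Projective A (reducedSubmodule G) :=
    Module.Projective.of_split (reducedSubmodule G).subtype
      (Submodule.projectionOnto _ _ (isCompl_reducedSubmodule hord hG hunit).symm)
      (Submodule.projectionOnto_comp_subtype _)
  exact Module.Flat.of_linearEquiv e

end LeadingTerms

/-! ### Gradings, and flatness implies units -/

section Graded

variable {k A : Type*} [Field k] [CommRing A] [Algebra k A] {𝒜 : ℕ → Submodule k A}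
  [GradedAlgebra 𝒜] {a : ℕ∞} {n r : ℕ}

theorem IsGradedTdvr.exists_algebraMap_eq (hA : IsGradedTdvr 𝒜 a) {x : A} (hx : x ∈ 𝒜 0) :
    ∃ c : k, algebraMap k A c = x := by
  rw [hA.eq_pow 0 (by exact_mod_cast hA.length_pos), pow_zero] at hx
  exact Submodule.mem_one.1 hx

theorem IsGradedTdvr.isUnit_of_mem_zero (hA : IsGradedTdvr 𝒜 a) {x : A} (hx : x ∈ 𝒜 0)
    (h0 : x ≠ 0) : IsUnit x := by
  obtain ⟨c, rfl⟩ := hA.exists_algebraMap_eq hx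
  refine (IsUnit.mk0 c ?_).map (algebraMap k A)
  rintro rfl
  exact h0 (map_zero _)

theorem IsGradedTdvr.exists_generator (hA : IsGradedTdvr 𝒜 a) {i : ℕ} {x : A} (hx : x ∈ 𝒜 i)
    (h0 : x ≠ 0) : ∃ w ∈ 𝒜 i, w ≠ 0 ∧ ∀ v ∈ 𝒜 i, ∃ c : k, c • w = v := by
  have hi : (i : ℕ∞) < a := by
    by_contra hi
    rw [hA.eq_bot i (not_lt.1 hi)] at hx
    exact h0 hx
  obtain ⟨w, hw0, hw⟩ := finrank_eq_one_iff'.1 (hA.finrank_eq_one i hi)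
  refine ⟨w, w.2, fun h => hw0 (Subtype.ext h), fun v hv => ?_⟩
  obtain ⟨c, hc⟩ := hw ⟨v, hv⟩
  exact ⟨c, congrArg Subtype.val hc⟩

/-- The degree-`i` component of `w * b` is `w` times the degree-0 component of `b`, which would be a
unit if nonzero. -/
theorem IsGradedTdvr.mem_irrelevant_of_mul_eq_zero (hA : IsGradedTdvr 𝒜 a) {i : ℕ} {w b : A}
    (hw : w ∈ 𝒜 i) (hw0 : w ≠ 0) (h : w * b = 0) : b ∈ (HomogeneousIdeal.irrelevant 𝒜).toIdeal := by
  change b ∈ HomogeneousIdeal.irrelevant 𝒜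
  rw [HomogeneousIdeal.mem_irrelevant_iff, GradedRing.proj_apply]
  by_contra hb
  have hu := hA.isUnit_of_mem_zero (SetLike.coe_mem (DirectSum.decompose 𝒜 b 0)) hb
  have hm := DirectSum.coe_decompose_mul_add_of_left_mem 𝒜 (j := 0) (b := b) hw
  rw [h] at hm
  exact hw0 ((hu.mul_left_eq_zero).1 (by simpa using hm.symm))

theorem IsGradedSubmodule.exists_component_zero
    {M : Submodule (MvPolynomial (Fin n) A) (FreeMod A n r)} (hM : IsGradedSubmodule 𝒜 M)
    {m : FreeMod A n r} (hm : m ∈ M) :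
    ∃ m₀ ∈ M, ∀ X, coeffAt m₀ X = GradedRing.proj 𝒜 0 (coeffAt m X) := by
  have hm' : m ∈ ⨆ i, M.restrictScalars k ⊓ degreePart 𝒜 n r i := hM ▸ hm
  induction hm' using Submodule.iSup_induction' with
  | mem i f hf =>
    by_cases hi : i = 0
    · subst hi
      exact ⟨f, hf.1, fun X => by
        rw [GradedRing.proj_apply, DirectSum.decompose_of_mem_same 𝒜 (hf.2 X)]⟩
    · exact ⟨0, M.zero_mem, fun X => by
        rw [coeffAt_zero, GradedRing.proj_apply, DirectSum.decompose_of_mem_ne 𝒜 (hf.2 X) hi]⟩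
  | zero => exact ⟨0, M.zero_mem, fun X => by rw [coeffAt_zero, map_zero]⟩
  | add f g hf hg ihf ihg =>
    rw [← hM] at hf hg
    obtain ⟨f₀, hf₀, hf₁⟩ := ihf hf
    obtain ⟨g₀, hg₀, hg₁⟩ := ihg hg
    exact ⟨f₀ + g₀, M.add_mem hf₀ hg₀, fun X => by
      rw [coeffAt_add, coeffAt_add, map_add, hf₁, hg₁]⟩

/-- Since `𝒜 i` is a line over `k`, all coefficients of `g` are scalar multiples of one generator
`w`. A scalar vanishes exactly when its multiple of `w` does, so the support is unchanged. -/
theorem IsGradedTdvr.exists_eq_smul (hA : IsGradedTdvr 𝒜 a) {g : FreeMod A n r} {i : ℕ}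
    (hg0 : g ≠ 0) (hg : g ∈ degreePart 𝒜 n r i) :
    ∃ w ∈ 𝒜 i, w ≠ 0 ∧ ∃ g' ∈ degreePart 𝒜 n r 0, g = w • g' ∧ supp g' = supp g := by
  classical
  obtain ⟨Y, hY⟩ : ∃ Y, coeffAt g Y ≠ 0 := by
    by_contra! h
    exact hg0 (ext_coeffAt fun X => by rw [h, coeffAt_zero])
  obtain ⟨w, hw, hw0, hgen⟩ := hA.exists_generator (hg Y) hY
  choose c hc using fun X => hgen _ (hg X)
  have hcoeff : ∀ X, coeffAt (∑ X ∈ supp g, monomialElt (algebraMap k A (c X)) X :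
      FreeMod A n r) X = algebraMap k A (c X) := by
    intro X
    rw [coeffAt_sum_monomialElt]
    split_ifs with hX
    · rfl
    · have h0 : c X • w = 0 := by rw [hc, ← not_ne_iff, ← mem_supp]; exact hX
      rw [(smul_eq_zero.1 h0).resolve_right hw0, map_zero]
  refine ⟨w, hw, hw0, ∑ X ∈ supp g, monomialElt (algebraMap k A (c X)) X, fun X => ?_,
    ext_coeffAt fun X => ?_, ?_⟩
  · rw [hcoeff]
    exact SetLike.algebraMap_mem_graded 𝒜 (c X)
  · rw [coeffAt_smul, hcoeff, ← hc, Algebra.smul_def, mul_comm]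
  · ext X
    rw [mem_supp, mem_supp, hcoeff, ← hc, Algebra.smul_def]
    refine not_congr ⟨fun h => by rw [h, zero_mul], fun h => ?_⟩
    rw [← Algebra.smul_def] at h
    rw [(smul_eq_zero.1 h).resolve_right hw0, map_zero]

/-- By the equational criterion, the relation `w • g = 0` in `L/M` is trivial: `g` is congruent mod
`M` to a combination whose coefficients are killed by `w`, hence irrelevant. Taking degree-0
components, which stay in `M`, leaves `g` itself. -/
theorem mem_of_smul_mem_of_flat (hA : IsGradedTdvr 𝒜 a)
    {M : Submodule (MvPolynomial (Fin n) A) (FreeMod A n r)} (hM : IsGradedSubmodule 𝒜 M)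
    [Module.Flat A (FreeMod A n r ⧸ M)] {i : ℕ} {w : A} (hw : w ∈ 𝒜 i) (hw0 : w ≠ 0)
    {g : FreeMod A n r} (hg : g ∈ degreePart 𝒜 n r 0) (hwg : w • g ∈ M) : g ∈ M := by
  have hrel : ∑ _j : Fin 1, w • M.mkQ g = 0 := by
    rw [Fin.sum_univ_one, ← LinearMap.map_smul_of_tower, Submodule.mkQ_apply,
      Submodule.Quotient.mk_eq_zero]
    exact hwg
  obtain ⟨κ, b, y, hy, hb⟩ := Module.Flat.isTrivialRelation_of_sum_smul_eq_zero hrel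
  choose z hz using fun j => M.mkQ_surjective (y j)
  have hmem : g - ∑ j, b 0 j • z j ∈ M := by
    rw [← Submodule.Quotient.mk_eq_zero, ← Submodule.mkQ_apply, map_sub, map_sum, sub_eq_zero]
    refine (hy 0).trans ?_
    exact Finset.sum_congr rfl fun j _ => by rw [LinearMap.map_smul_of_tower, hz]
  obtain ⟨m₀, hm₀, hcoeff⟩ := hM.exists_component_zero hmem
  convert hm₀
  refine ext_coeffAt fun X => ?_
  have hirr : coeffAt (∑ j, b 0 j • z j) X ∈ (HomogeneousIdeal.irrelevant 𝒜).toIdeal := by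
    rw [coeffAt_sum]
    refine Ideal.sum_mem _ fun j _ => ?_
    rw [coeffAt_smul]
    exact Ideal.mul_mem_right _ _ (hA.mem_irrelevant_of_mul_eq_zero hw hw0 (by simpa using hb j))
  have h0 := (HomogeneousIdeal.mem_irrelevant_iff 𝒜 _).1 hirr
  rw [hcoeff, coeffAt_sub, map_sub, h0, sub_zero, GradedRing.proj_apply,
    DirectSum.decompose_of_mem_same 𝒜 (hg X)]

theorem isUnit_leadCoeff_of_flat (hA : IsGradedTdvr 𝒜 a) [LinearOrder (PowerProduct n r)]
    (hord : IsTermOrder n r) {M : Submodule (MvPolynomial (Fin n) A) (FreeMod A n r)}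
    (hM : IsGradedSubmodule 𝒜 M) {G : Finset (FreeMod A n r)} (hG : IsGroebnerBasis G M)
    (hhom : ∀ g ∈ G, IsHomogeneousElt 𝒜 g) (hmin : IsMinimalBasis G)
    [Module.Flat A (FreeMod A n r ⧸ M)] {g : FreeMod A n r} (hg : g ∈ G) :
    IsUnit (leadCoeff g) := by
  classical
  obtain ⟨hg0, i, hgi⟩ := hhom g hg
  obtain ⟨w, hw, hw0, g', hg', hgw, hsupp⟩ := hA.exists_eq_smul hg0 hgi
  have hg'M : g' ∈ M := mem_of_smul_mem_of_flat hA hM hw hw0 hg' (hgw ▸ (hG.1 g hg).1)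
  obtain ⟨X, hX⟩ := exists_leadMonomial_eq hg0
  have hX' : leadMonomial g' = X := by rw [leadMonomial, hsupp, ← hX, leadMonomial]
  have hlt : leadTerm g' ∈ ltSubmodule (G : Set (FreeMod A n r)) := by
    rw [hG.2]
    exact Submodule.subset_span ⟨g', hg'M, rfl⟩
  -- Otherwise the leading coefficient of `g'`, nonzero of degree 0, would be irrelevant.
  obtain ⟨h, hh, hdvd, hirr⟩ : ∃ h ∈ G, LeadDivides h X ∧
      leadCoeff h ∉ (HomogeneousIdeal.irrelevant 𝒜).toIdeal := by
    by_contra! hcon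
    have hmem := coeffAt_mem_of_mem_ltSubmodule hlt _ hcon
    rw [leadTerm_eq hX', coeffAt_monomialElt, if_pos rfl] at hmem
    have h0 := (HomogeneousIdeal.mem_irrelevant_iff 𝒜 _).1 hmem
    rw [GradedRing.proj_apply, leadCoeff_eq hX', DirectSum.decompose_of_mem_same 𝒜 (hg' X),
      ← leadCoeff_eq hX'] at h0
    exact leadCoeff_ne_zero hX' h0
  have hunit : IsUnit (leadCoeff h) := by
    obtain ⟨-, j, hj⟩ := hhom h hh
    obtain ⟨-, Y, hY, -⟩ := hdvd
    rw [leadCoeff_eq hY] at hirr ⊢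
    obtain rfl : j = 0 := by
      by_contra hj0
      refine hirr ((HomogeneousIdeal.mem_irrelevant_iff 𝒜 _).2 ?_)
      rw [GradedRing.proj_apply, DirectSum.decompose_of_mem_ne 𝒜 (hj Y) hj0]
    refine hA.isUnit_of_mem_zero (hj Y) ?_
    rw [← leadCoeff_eq hY]
    exact leadCoeff_ne_zero hY
  by_cases hgh : h = g
  · exact hgh ▸ hunit
  · exact absurd (exists_reducesStrictly hord (Finset.mem_erase.2 ⟨hgh, hh⟩) hX hdvd hunit)
      -- `convert` reconciles the decidability instances in the two occurrences of `erase`.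
      (by convert hmin g hg)

end Graded

end GroebnerFlat

open GroebnerFlat
theorem mainTheorem3 {k A : Type*} [Field k] [CommRing A] [Algebra k A]
    (𝒜 : ℕ → Submodule k A) [GradedAlgebra 𝒜] (a : ℕ∞) (hA : IsGradedTdvr 𝒜 a)
    (n r : ℕ) [LinearOrder (PowerProduct n r)] (hord : IsTermOrder n r)
    (M : Submodule (MvPolynomial (Fin n) A) (FreeMod A n r)) (hM0 : M ≠ ⊥)
    (hM : IsGradedSubmodule 𝒜 M)
    (G : Finset (FreeMod A n r)) (hG : IsGroebnerBasis G M)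
    (hhom : ∀ g ∈ G, IsHomogeneousElt 𝒜 g) (hmin : IsMinimalBasis G) :
    Module.Flat A (FreeMod A n r ⧸ M) ↔ ∀ g ∈ G, IsUnit (leadCoeff g) :=
  ⟨fun _ _ hg => isUnit_leadCoeff_of_flat hA hord hM hG hhom hmin hg,
    flat_quotient_of_isUnit_leadCoeff hord hG⟩
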